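/- Let $n\ge 2$ and let $M$ be a compact smooth $n$-dimensional manifold with boundary, equipped with a Riemannian metric. Let $f: M\to[a,b]\subset\mathbb{R}$ be a smooth Morse function, i.e. a smooth function whose Hessian is non-degenerate at every critical point, and suppose that $f(\partial M)=\{a,b\}$. Suppose that for all $c,d\in[a,b]$ the level sets $f^{-1}(c)$ and $f^{-1}(d)$ are diffeomorphic, that is, there is a bijection $f^{-1}(c)\to f^{-1}(d)$ such that it and its inverse are locally restrictions of smooth maps from open subsets of $M$ to $M$. Then $f$ has no critical points on $M$ (boundary included), and there is a constant $C>0$ such that $\|\nabla f(x)\|\ge C$ for all $x\in M$. -/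

import Mathlib

open Set Manifold Bundle
open scoped ContDiff

noncomputable section

/-- A map `g` from a subset `X` of a manifold `M` to a manifold `N` is smooth if, around every point
of `X`, it is the restriction of a smooth map from an open subset of `M` to `N`. -/
def SmoothOnSubset
    {E : Type*} [NormedAddCommGroup E] [NormedSpace ℝ E] {H : Type*} [TopologicalSpace H]
    (I : ModelWithCorners ℝ E H) {M : Type*} [TopologicalSpace M] [ChartedSpace H M]
    {E' : Type*} [NormedAddCommGroup E'] [NormedSpace ℝ E'] {H' : Type*} [TopologicalSpace H']
    (J : ModelWithCorners ℝ E' H') {N : Type*} [TopologicalSpace N] [ChartedSpace H' N]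
    (X : Set M) (g : X → N) : Prop :=
  ∀ x : X, ∃ U : Set M, IsOpen U ∧ (x : M) ∈ U ∧
    ∃ F : M → N, ContMDiffOn I J ∞ F U ∧ ∀ y : X, (y : M) ∈ U → F y = g y

/-- Two subsets `X`, `Y` of a manifold are diffeomorphic if there is a bijection between them that is
smooth in both directions. No submanifold structure on `X` or `Y` is presupposed; for embedded
submanifolds this is the usual notion. -/
def DiffeomorphicSubsets
    {E : Type*} [NormedAddCommGroup E] [NormedSpace ℝ E] {H : Type*} [TopologicalSpace H]
    (I : ModelWithCorners ℝ E H) {M : Type*} [TopologicalSpace M] [ChartedSpace H M]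
    (X Y : Set M) : Prop :=
  ∃ e : X ≃ Y, SmoothOnSubset I I X (fun x => (e x : M)) ∧
    SmoothOnSubset I I Y (fun y => (e.symm y : M))

/-- A critical point of a real function on a manifold: a point where the differential vanishes. -/
def IsCriticalPt
    {E : Type*} [NormedAddCommGroup E] [NormedSpace ℝ E] {H : Type*} [TopologicalSpace H]
    (I : ModelWithCorners ℝ E H) {M : Type*} [TopologicalSpace M] [ChartedSpace H M]
    (f : M → ℝ) (x : M) : Prop :=
  mfderiv I 𝓘(ℝ, ℝ) f x = 0

/-- The second derivative at `x` of `f` read in the preferred chart at `x`. At a critical point this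
is the Hessian of `f`, and whether it is degenerate does not depend on the chart. -/
def chartHessian
    {E : Type*} [NormedAddCommGroup E] [NormedSpace ℝ E] {H : Type*} [TopologicalSpace H]
    (I : ModelWithCorners ℝ E H) {M : Type*} [TopologicalSpace M] [ChartedSpace H M]
    (f : M → ℝ) (x : M) : E →L[ℝ] E →L[ℝ] ℝ :=
  fderivWithin ℝ (fderivWithin ℝ (f ∘ (extChartAt I x).symm) (range I)) (range I)
    (extChartAt I x x)

/-- A smooth function whose Hessian is a nondegenerate bilinear form at every critical point. -/
structure IsMorseFunction
    {E : Type*} [NormedAddCommGroup E] [NormedSpace ℝ E] {H : Type*} [TopologicalSpace H]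
    (I : ModelWithCorners ℝ E H) {M : Type*} [TopologicalSpace M] [ChartedSpace H M]
    (f : M → ℝ) : Prop where
  smooth : ContMDiff I 𝓘(ℝ, ℝ) ∞ f
  nondegenerate : ∀ x, IsCriticalPt I f x →
    ∀ u : E, (∀ v : E, chartHessian I f x u v = 0) → u = 0

/-- The gradient of `f` at `x` for a Riemannian metric on `M`: the tangent vector that represents the
differential of `f` at `x` through the inner product of the tangent space. -/
def riemannianGradient
    {E : Type*} [NormedAddCommGroup E] [NormedSpace ℝ E] [FiniteDimensional ℝ E]
    {H : Type*} [TopologicalSpace H]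
    (I : ModelWithCorners ℝ E H) {M : Type*} [TopologicalSpace M] [ChartedSpace H M]
    [RiemannianBundle (fun x : M => TangentSpace I x)]
    (f : M → ℝ) (x : M) : TangentSpace I x :=
  haveI : FiniteDimensional ℝ (TangentSpace I x) := inferInstanceAs (FiniteDimensional ℝ E)
  haveI : CompleteSpace (TangentSpace I x) := FiniteDimensional.complete ℝ (TangentSpace I x)
  (InnerProductSpace.toDual ℝ (TangentSpace I x)).symm (mfderiv I 𝓘(ℝ, ℝ) f x)

end

/-
The tangent cone of a level set at a nondegenerate critical point is the null cone of the Hessian,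
and at a regular point it is a hyperplane. A diffeomorphism of the level sets therefore carries a
subspace of dimension `n - 1` onto the null cone of a nondegenerate quadratic form, which is
impossible for `n ≥ 2`: a nonzero isotropic hyperplane forces the form to take every value off it.
Since there are only finitely many critical values, each level set is compared with a regular one.

On the boundary `f` takes only the values `a` and `b`, so it is locally constant there, and at a
critical point on the boundary the Hessian is isotropic on the boundary hyperplane. It then takes
both signs on inward directions, although `f` has an extremum there. The lower bound on the gradient
follows by compactness.
-/

open Filter Topology Asymptotics

theorem exists_mem_apply_add_self_eq {K V : Type*} [Field K] [NeZero (2 : K)] [AddCommGroup V]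
    [Module K V] {B : LinearMap.BilinForm K V} (hsymm : B.IsSymm) (hB : B.SeparatingLeft)
    {W : Submodule K V} (hW : IsCoatom W) (hW₀ : W ≠ ⊥) (hWB : ∀ w ∈ W, B w w = 0)
    {u : V} (hu : u ∉ W) (r : K) : ∃ w ∈ W, B (u + w) (u + w) = r := by
  obtain ⟨w, hw, hw₀⟩ := W.ne_bot_iff.1 hW₀
  have hwW : ∀ w' ∈ W, B w w' = 0 := fun w' hw' => by
    have h := hWB _ (W.add_mem hw hw')
    simp only [map_add, LinearMap.add_apply, hWB _ hw, hWB _ hw', hsymm.eq w' w, zero_add,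
      add_zero, ← two_mul] at h
    exact (mul_eq_zero.1 h).resolve_left two_ne_zero
  have hwu : B w u ≠ 0 := fun h => hw₀ <| hB w fun v => by
    obtain ⟨w', hw', z, hz, rfl⟩ := Submodule.mem_sup.1
      ((Submodule.isCompl_span_singleton_of_isCoatom_of_notMem hW hu).sup_eq_top ▸
        Submodule.mem_top (x := v))
    obtain ⟨k, rfl⟩ := Submodule.mem_span_singleton.1 hz
    simp only [map_add, map_smul, hwW w' hw', h, smul_zero, add_zero]
  refine ⟨((r - B u u) / (2 * B w u)) • w, W.smul_mem _ hw, ?_⟩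
  simp only [map_add, map_smul, LinearMap.add_apply, LinearMap.smul_apply, smul_eq_mul,
    hWB _ hw, hsymm.eq u w]
  field_simp
  ring

theorem coe_ne_setOf_apply_self_eq_zero {K V : Type*} [Field K] [NeZero (2 : K)] [AddCommGroup V]
    [Module K V] {B : LinearMap.BilinForm K V} (hsymm : B.IsSymm) (hB : B.SeparatingLeft)
    {W : Submodule K V} (hW : IsCoatom W) (hW₀ : W ≠ ⊥) : (W : Set V) ≠ {v | B v v = 0} := by
  intro h
  obtain ⟨u, -, hu⟩ := SetLike.exists_of_lt hW.lt_top
  obtain ⟨w, hw, hBw⟩ := exists_mem_apply_add_self_eq hsymm hB hW hW₀ (fun w hw => h.subset hw) hu 0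
  exact hu ((W.add_mem_iff_left hw).1 (h.superset hBw))

theorem isCoatom_of_finrank_add_one_eq {K V : Type*} [DivisionRing K] [AddCommGroup V] [Module K V]
    [FiniteDimensional K V] {W : Submodule K V}
    (h : Module.finrank K W + 1 = Module.finrank K V) : IsCoatom W := by
  rw [← isSimpleModule_iff_isCoatom, isSimpleModule_iff_finrank_eq_one]
  have := W.finrank_quotient_add_finrank
  omega

theorem eventually_lt_of_tendsto_div_pow {g : ℝ → ℝ} {c l : ℝ} {k : ℕ}
    (h : Tendsto (fun t => (g t - c) / t ^ k) (𝓝[>] 0) (𝓝 l)) (hl : 0 < l) :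
    ∀ᶠ t in 𝓝[>] 0, c < g t := by
  filter_upwards [h.eventually_const_lt hl, self_mem_nhdsWithin] with t ht (ht₀ : 0 < t)
  exact sub_pos.1 ((div_pos_iff_of_pos_right (pow_pos ht₀ k)).1 ht)

theorem eventually_gt_of_tendsto_div_pow {g : ℝ → ℝ} {c l : ℝ} {k : ℕ}
    (h : Tendsto (fun t => (g t - c) / t ^ k) (𝓝[>] 0) (𝓝 l)) (hl : l < 0) :
    ∀ᶠ t in 𝓝[>] 0, g t < c := by
  have h' : Tendsto (fun t => (-g t - -c) / t ^ k) (𝓝[>] 0) (𝓝 (-l)) := by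
    refine h.neg.congr fun t => ?_
    ring
  exact (eventually_lt_of_tendsto_div_pow h' (neg_pos.2 hl)).mono fun t => neg_lt_neg_iff.1

section TangentCone

variable {E : Type*} [NormedAddCommGroup E] [NormedSpace ℝ E]
  {φ q : E → ℝ} {q' : E →L[ℝ] ℝ} {s : Set E} {x₀ v : E}

theorem tendsto_add_smul_nhdsGT (x₀ v : E) :
    Tendsto (fun t : ℝ => x₀ + t • v) (𝓝[>] 0) (𝓝 x₀) :=
  ((by fun_prop : Continuous fun t : ℝ => x₀ + t • v).tendsto' 0 x₀ (by simp)).mono_left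
    nhdsWithin_le_nhds

theorem tendsto_smul_nhdsGT_prod_nhds (v : E) :
    Tendsto (fun p : ℝ × E => p.1 • p.2) (𝓝[>] 0 ×ˢ 𝓝 v) (𝓝 0) := by
  have h : Tendsto (fun p : ℝ × E => p.1 • p.2) (𝓝 0 ×ˢ 𝓝 v) (𝓝 0) := by
    rw [← nhds_prod_eq]
    exact continuous_smul.tendsto' _ _ (zero_smul ℝ v)
  exact h.mono_left (prod_mono_left _ nhdsWithin_le_nhds)

theorem mem_tangentConeAt_of_frequently_add_smul
    (h : ∃ᶠ p : ℝ × E in 𝓝[>] 0 ×ˢ 𝓝 v, x₀ + p.1 • p.2 ∈ s) : v ∈ tangentConeAt ℝ s x₀ := by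
  refine mem_tangentConeAt_of_frequently _ (fun p : ℝ × E => p.1⁻¹) (fun p => p.1 • p.2)
    (tendsto_smul_nhdsGT_prod_nhds v) h (tendsto_snd.congr' ?_)
  filter_upwards [tendsto_fst.eventually self_mem_nhdsWithin] with p (hp : 0 < p.1)
  exact (inv_smul_smul₀ hp.ne' _).symm

theorem mem_tangentConeAt_levelSet (hφ : ∀ᶠ x in 𝓝 x₀, ContinuousAt φ x)
    (hlt : ∃ᶠ z in 𝓝 v, ∀ᶠ t : ℝ in 𝓝[>] 0, φ (x₀ + t • z) < φ x₀)
    (hgt : ∃ᶠ z in 𝓝 v, ∀ᶠ t : ℝ in 𝓝[>] 0, φ x₀ < φ (x₀ + t • z)) :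
    v ∈ tangentConeAt ℝ {x | φ x = φ x₀} x₀ := by
  refine mem_tangentConeAt_of_frequently_add_smul fun hne => ?_
  have htend : Tendsto (fun p : ℝ × E => x₀ + p.1 • p.2) (𝓝[>] 0 ×ˢ 𝓝 v) (𝓝 x₀) := by
    simpa only [add_zero] using (tendsto_smul_nhdsGT_prod_nhds v).const_add x₀
  obtain ⟨P, hP, R, hR, hPR⟩ := eventually_prod_iff.1 (hne.and (htend.eventually hφ))
  obtain ⟨η, hη, hball⟩ := Metric.eventually_nhds_iff_ball.1 hR
  obtain ⟨z₁, hz₁, hz₁η⟩ := (hlt.and_eventually (Metric.ball_mem_nhds v hη)).exists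
  obtain ⟨z₂, hz₂, hz₂η⟩ := (hgt.and_eventually (Metric.ball_mem_nhds v hη)).exists
  obtain ⟨t, ht₁, ht₂, ht⟩ := (hz₁.and (hz₂.and hP)).exists
  have hcont : ContinuousOn (fun z => φ (x₀ + t • z)) (Metric.ball v η) := fun z hz =>
    (ContinuousAt.comp (f := fun z => x₀ + t • z) (hPR ht (hball z hz)).2
      (by fun_prop)).continuousWithinAt
  obtain ⟨z, hz, hφz⟩ := (convex_ball v η).isPreconnected.intermediate_value hz₁η hz₂η hcont
    ⟨ht₁.le, ht₂.le⟩
  exact (hPR ht (hball z hz)).1 hφz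

/- Near a point where its derivative is nonzero, the leading term `q` takes both signs, and the sign
of `q z` is that of `φ - φ x₀` on a short ray from `x₀` in the direction `z`. -/
theorem mem_tangentConeAt_levelSet_of_tendsto_div_pow (hφ : ∀ᶠ x in 𝓝 x₀, ContinuousAt φ x)
    {k : ℕ} (hq : ∀ z, Tendsto (fun t : ℝ => (φ (x₀ + t • z) - φ x₀) / t ^ k) (𝓝[>] 0) (𝓝 (q z)))
    (hv : q v = 0) (hq' : HasFDerivAt q q' v) (hne : q' ≠ 0) :
    v ∈ tangentConeAt ℝ {x | φ x = φ x₀} x₀ := by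
  have hlt : ∃ᶠ z in 𝓝 v, q z < 0 := fun h =>
    hne (IsLocalMin.hasFDerivAt_eq_zero (h.mono fun z hz => hv ▸ not_lt.1 hz) hq')
  have hgt : ∃ᶠ z in 𝓝 v, 0 < q z := fun h =>
    hne (IsLocalMax.hasFDerivAt_eq_zero (h.mono fun z hz => hv ▸ not_lt.1 hz) hq')
  exact mem_tangentConeAt_levelSet hφ
    (hlt.mono fun z => eventually_gt_of_tendsto_div_pow (hq z))
    (hgt.mono fun z => eventually_lt_of_tendsto_div_pow (hq z))

theorem tangentConeAt_levelSet_eq_ker {φ' : E →L[ℝ] ℝ} (hφ : ∀ᶠ x in 𝓝 x₀, ContinuousAt φ x)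
    (hφ' : HasFDerivAt φ φ' x₀) (hne : φ' ≠ 0) :
    tangentConeAt ℝ {x | φ x = φ x₀} x₀ = φ'.ker := by
  refine Subset.antisymm (fun v hv => ?_) fun v hv => ?_
  · have hconst : HasFDerivWithinAt φ (0 : E →L[ℝ] ℝ) {x | φ x = φ x₀} x₀ :=
      (hasFDerivWithinAt_const (φ x₀) x₀ _).congr (fun x hx => hx) rfl
    exact hφ'.hasFDerivWithinAt.unique_on hconst hv
  · refine mem_tangentConeAt_levelSet_of_tendsto_div_pow (q := φ') (k := 1) hφ (fun z => ?_)
      hv φ'.hasFDerivAt hne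
    simpa only [pow_one, div_eq_inv_mul, smul_eq_mul] using
      (hφ'.hasLineDerivAt z).tendsto_slope_zero_right

end TangentCone

section CriticalHessian

variable {E : Type*} [NormedAddCommGroup E] [NormedSpace ℝ E]
  {φ : E → ℝ} {Q : E →L[ℝ] E →L[ℝ] ℝ} {s : Set E} {x₀ v : E}

/-- `x₀` is a critical point of `φ` within `s` with Hessian form `Q`, in the sense of the second
order Taylor expansion of `φ` at `x₀` with Peano remainder. -/
def HasCriticalHessianWithinAt (φ : E → ℝ) (Q : E →L[ℝ] E →L[ℝ] ℝ) (s : Set E) (x₀ : E) : Prop :=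
  (fun x => φ x - φ x₀ - 2⁻¹ * Q (x - x₀) (x - x₀)) =o[𝓝[s] x₀] fun x => ‖x - x₀‖ ^ 2

theorem hasFDerivAt_half_apply_sub_self (hQ : ∀ u v, Q u v = Q v u) (x₀ y : E) :
    HasFDerivAt (fun y => 2⁻¹ * Q (y - x₀) (y - x₀)) (Q (y - x₀)) y := by
  have hsub : HasFDerivAt (fun y : E => y - x₀) (ContinuousLinearMap.id ℝ E) y :=
    (hasFDerivAt_id y).sub_const x₀
  refine (((Q.hasFDerivAt.comp y hsub).clm_apply hsub).const_mul (2⁻¹ : ℝ)).congr_fderiv ?_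
  ext v
  simp only [Function.comp_apply, map_sub, ContinuousLinearMap.comp_id, smul_add, add_apply,
    smul_apply, sub_apply, smul_eq_mul, ContinuousLinearMap.flip_apply, hQ v]
  ring

theorem hasCriticalHessianWithinAt_of_hasFDerivWithinAt (hs : Convex ℝ s) (hx₀ : x₀ ∈ s)
    {φ' : E → E →L[ℝ] ℝ} (hφ : ∀ᶠ x in 𝓝[s] x₀, HasFDerivWithinAt φ (φ' x) s x) (h₀ : φ' x₀ = 0)
    (hφ' : HasFDerivWithinAt φ' Q s x₀) (hQ : ∀ u v, Q u v = Q v u) :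
    HasCriticalHessianWithinAt φ Q s x₀ := by
  refine isLittleO_iff.2 fun ε hε => ?_
  obtain ⟨δ, hδ, hδs⟩ := Metric.eventually_nhds_iff.1 <|
    eventually_nhdsWithin_iff.1 (hφ.and (hφ'.isLittleO.def hε))
  refine eventually_nhdsWithin_iff.2 (Metric.eventually_nhds_iff.2 ⟨δ, hδ, fun x hx hxs => ?_⟩)
  have hyδ : ∀ y ∈ Metric.closedBall x₀ ‖x - x₀‖, dist y x₀ < δ := fun y hy =>
    (Metric.mem_closedBall.1 hy).trans_lt (dist_eq_norm x x₀ ▸ hx)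
  have hderiv : ∀ y ∈ s ∩ Metric.closedBall x₀ ‖x - x₀‖, HasFDerivWithinAt
      (fun y => φ y - 2⁻¹ * Q (y - x₀) (y - x₀)) (φ' y - Q (y - x₀))
      (s ∩ Metric.closedBall x₀ ‖x - x₀‖) y := fun y hy =>
    ((hδs (hyδ y hy.2) hy.1).1.mono inter_subset_left).sub
      (hasFDerivAt_half_apply_sub_self hQ x₀ y).hasFDerivWithinAt
  have hbound : ∀ y ∈ s ∩ Metric.closedBall x₀ ‖x - x₀‖,
      ‖φ' y - Q (y - x₀)‖ ≤ ε * ‖x - x₀‖ := fun y hy => by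
    have hy' := (hδs (hyδ y hy.2) hy.1).2
    rw [h₀, sub_zero] at hy'
    exact hy'.trans (by gcongr; exact mem_closedBall_iff_norm.1 hy.2)
  have hmean := (hs.inter (convex_closedBall x₀ _)).norm_image_sub_le_of_norm_hasFDerivWithin_le
    hderiv hbound ⟨hx₀, by simp⟩ ⟨hxs, by simp [dist_eq_norm]⟩
  calc ‖φ x - φ x₀ - 2⁻¹ * Q (x - x₀) (x - x₀)‖
      = ‖φ x - 2⁻¹ * Q (x - x₀) (x - x₀) - (φ x₀ - 2⁻¹ * Q (x₀ - x₀) (x₀ - x₀))‖ := by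
        rw [sub_self, map_zero, mul_zero, sub_zero, sub_right_comm]
    _ ≤ ε * ‖x - x₀‖ * ‖x - x₀‖ := hmean
    _ = ε * ‖‖x - x₀‖ ^ 2‖ := by rw [norm_pow, norm_norm]; ring

namespace HasCriticalHessianWithinAt

theorem univ_of_mem_nhds (h : HasCriticalHessianWithinAt φ Q s x₀) (hs : s ∈ 𝓝 x₀) :
    HasCriticalHessianWithinAt φ Q univ x₀ := by
  rwa [HasCriticalHessianWithinAt, nhdsWithin_univ, ← nhdsWithin_eq_nhds.2 hs]

theorem tendsto_div_sq (h : HasCriticalHessianWithinAt φ Q s x₀)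
    (hv : ∀ᶠ t : ℝ in 𝓝[>] 0, x₀ + t • v ∈ s) :
    Tendsto (fun t : ℝ => (φ (x₀ + t • v) - φ x₀) / t ^ 2) (𝓝[>] 0) (𝓝 (2⁻¹ * Q v v)) := by
  have hray := h.comp_tendsto (tendsto_nhdsWithin_iff.2 ⟨tendsto_add_smul_nhdsGT x₀ v, hv⟩)
  have hnorm : (fun t : ℝ => ‖t • v‖ ^ 2) =O[𝓝[>] 0] fun t : ℝ => t ^ 2 :=
    .of_bound (‖v‖ ^ 2) (.of_forall fun t => by simp [norm_smul, mul_pow, mul_comm])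
  have hrem : (fun t : ℝ => φ (x₀ + t • v) - φ x₀ - t ^ 2 * (2⁻¹ * Q v v)) =o[𝓝[>] 0]
      fun t : ℝ => t ^ 2 := by
    refine (hray.congr (fun t => ?_) fun t => ?_).trans_isBigO hnorm
    · simp only [Function.comp_apply, add_sub_cancel_left, map_smul, smul_apply,
        smul_eq_mul]
      ring
    · simp only [Function.comp_apply, add_sub_cancel_left]
  have hlim := hrem.tendsto_div_nhds_zero.add_const (2⁻¹ * Q v v)
  rw [zero_add] at hlim
  refine hlim.congr' ?_
  filter_upwards [self_mem_nhdsWithin] with t (ht : 0 < t)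
  field_simp
  ring

theorem apply_self_nonneg_of_isLocalMinOn (h : HasCriticalHessianWithinAt φ Q s x₀)
    (hmin : IsLocalMinOn φ s x₀) (hv : ∀ᶠ t : ℝ in 𝓝[>] 0, x₀ + t • v ∈ s) : 0 ≤ Q v v := by
  by_contra! hneg
  have hlt := eventually_gt_of_tendsto_div_pow (h.tendsto_div_sq hv) (by linarith)
  have hge := (tendsto_nhdsWithin_iff.2 ⟨tendsto_add_smul_nhdsGT x₀ v, hv⟩).eventually hmin
  obtain ⟨t, ht, ht'⟩ := (hlt.and hge).exists
  exact ht.not_ge ht'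

theorem neg (h : HasCriticalHessianWithinAt φ Q s x₀) :
    HasCriticalHessianWithinAt (-φ) (-Q) s x₀ := by
  refine (isLittleO_neg_left.2 h).congr_left fun x => ?_
  simp only [Pi.neg_apply, neg_apply]
  ring

theorem apply_self_nonpos_of_isLocalMaxOn (h : HasCriticalHessianWithinAt φ Q s x₀)
    (hmax : IsLocalMaxOn φ s x₀) (hv : ∀ᶠ t : ℝ in 𝓝[>] 0, x₀ + t • v ∈ s) : Q v v ≤ 0 :=
  neg_nonneg.1 (h.neg.apply_self_nonneg_of_isLocalMinOn hmax.neg hv)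

theorem apply_self_eq_zero_of_mem_tangentConeAt (h : HasCriticalHessianWithinAt φ Q s x₀)
    (hv : v ∈ tangentConeAt ℝ {x ∈ s | φ x = φ x₀} x₀) : Q v v = 0 := by
  obtain ⟨α, l, _, c, d, hd, hmem, hcd⟩ := exists_fun_of_mem_tangentConeAt hv
  have hxd : Tendsto (fun n => x₀ + d n) l (𝓝[s] x₀) :=
    tendsto_nhdsWithin_iff.2 ⟨by simpa using hd.const_add x₀, hmem.mono fun n hn => hn.1⟩
  have hQd : (fun n => Q (d n) (d n)) =o[l] fun n => ‖d n‖ ^ 2 := by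
    refine ((h.comp_tendsto hxd).const_mul_left (-2)).congr' ?_ (.of_forall fun n => by simp)
    filter_upwards [hmem] with n hn
    simp only [Function.comp_apply, hn.2, add_sub_cancel_left]
    ring
  have hQcd : (fun n => Q (c n • d n) (c n • d n)) =o[l] fun n => ‖c n • d n‖ ^ 2 :=
    ((isBigO_refl (fun n => c n ^ 2) l).mul_isLittleO hQd).congr
      (fun n => by simp only [map_smul, smul_apply, smul_eq_mul]; ring)
      fun n => by simp [norm_smul, mul_pow]
  have hlim : Tendsto (fun n => Q (c n • d n) (c n • d n)) l (𝓝 (Q v v)) :=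
    ((by fun_prop : Continuous fun w => Q w w).tendsto v).comp hcd
  exact tendsto_nhds_unique hlim <|
    (isLittleO_one_iff ℝ).1 (hQcd.trans_isBigO ((hcd.norm.pow 2).isBigO_one ℝ))

theorem mem_tangentConeAt_levelSet (h : HasCriticalHessianWithinAt φ Q univ x₀)
    (hφ : ∀ᶠ x in 𝓝 x₀, ContinuousAt φ x) (hQ : ∀ u v, Q u v = Q v u) (hv : Q v v = 0)
    (hne : Q v ≠ 0) : v ∈ tangentConeAt ℝ {x | φ x = φ x₀} x₀ := by
  refine mem_tangentConeAt_levelSet_of_tendsto_div_pow (q := fun z => 2⁻¹ * Q z z) hφ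
    (fun z => h.tendsto_div_sq (by simp)) (by simp [hv]) (q' := Q v) ?_ hne
  simpa only [sub_zero] using hasFDerivAt_half_apply_sub_self hQ 0 v

theorem tangentConeAt_levelSet_eq (h : HasCriticalHessianWithinAt φ Q univ x₀)
    (hφ : ∀ᶠ x in 𝓝 x₀, ContinuousAt φ x) (hQ : ∀ u v, Q u v = Q v u)
    (hnd : ∀ u, (∀ v, Q u v = 0) → u = 0) :
    tangentConeAt ℝ {x | φ x = φ x₀} x₀ = {v | Q v v = 0} := by
  refine Subset.antisymm
    (fun v hv => h.apply_self_eq_zero_of_mem_tangentConeAt (by simpa using hv)) fun v hv => ?_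
  rcases eq_or_ne v 0 with rfl | hv₀
  · exact zero_mem_tangentConeAt (subset_closure rfl)
  · exact h.mem_tangentConeAt_levelSet hφ hQ hv fun hv' => hv₀ (hnd v (DFunLike.congr_fun hv'))

end HasCriticalHessianWithinAt

end CriticalHessian

section GermEquiv

/-- `F` and `G` induce mutually inverse homeomorphisms between the germ of the set `X` at `x₀` and
the germ of the set `Y` at `y₀`. Nothing is assumed about `F` and `G` away from `X` and `Y`. -/
structure IsGermEquiv {α β : Type*} [TopologicalSpace α] [TopologicalSpace β]
    (F : α → β) (G : β → α) (X : Set α) (Y : Set β) (x₀ : α) (y₀ : β) : Prop where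
  map_eq : F x₀ = y₀
  inv_eq : G y₀ = x₀
  tendsto : Tendsto F (𝓝[X] x₀) (𝓝[Y] y₀)
  tendsto_inv : Tendsto G (𝓝[Y] y₀) (𝓝[X] x₀)
  left_inv : ∀ᶠ x in 𝓝[X] x₀, G (F x) = x
  right_inv : ∀ᶠ y in 𝓝[Y] y₀, F (G y) = y

namespace IsGermEquiv

section Topology

variable {α β γ : Type*} [TopologicalSpace α] [TopologicalSpace β] [TopologicalSpace γ]
  {F : α → β} {G : β → α} {F₁ : β → γ} {G₁ : γ → β} {X : Set α} {Y : Set β} {Z : Set γ}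
  {x₀ : α} {y₀ : β} {z₀ : γ}

theorem symm (h : IsGermEquiv F G X Y x₀ y₀) : IsGermEquiv G F Y X y₀ x₀ :=
  ⟨h.inv_eq, h.map_eq, h.tendsto_inv, h.tendsto, h.right_inv, h.left_inv⟩

theorem trans (h : IsGermEquiv F G X Y x₀ y₀) (h₁ : IsGermEquiv F₁ G₁ Y Z y₀ z₀) :
    IsGermEquiv (F₁ ∘ F) (G ∘ G₁) X Z x₀ z₀ where
  map_eq := by rw [Function.comp_apply, h.map_eq, h₁.map_eq]
  inv_eq := by rw [Function.comp_apply, h₁.inv_eq, h.inv_eq]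
  tendsto := h₁.tendsto.comp h.tendsto
  tendsto_inv := h.tendsto_inv.comp h₁.tendsto_inv
  left_inv := by
    filter_upwards [h.left_inv, h.tendsto.eventually h₁.left_inv] with x hx hFx
    simp only [Function.comp_apply, hFx, hx]
  right_inv := by
    filter_upwards [h₁.right_inv, h₁.tendsto_inv.eventually h.right_inv] with z hz hGz
    simp only [Function.comp_apply, hGz, hz]

end Topology

variable {E E' : Type*} [NormedAddCommGroup E] [NormedSpace ℝ E] [NormedAddCommGroup E']
  [NormedSpace ℝ E'] {F : E → E'} {G : E' → E} {F' : E →L[ℝ] E'} {G' : E' →L[ℝ] E}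
  {X : Set E} {Y : Set E'} {x₀ : E} {y₀ : E'} {v : E}

theorem mapsTo_tangentConeAt (h : IsGermEquiv F G X Y x₀ y₀) (hF : HasFDerivAt F F' x₀) :
    MapsTo F' (tangentConeAt ℝ X x₀) (tangentConeAt ℝ Y y₀) := fun v hv => by
  obtain ⟨U, hU, hUX⟩ :=
    mem_nhdsWithin_iff_exists_mem_nhds_inter.1 (h.tendsto self_mem_nhdsWithin)
  have hFv := (hF.hasFDerivWithinAt (s := X ∩ U)).mapsTo_tangent_cone
    ((tangentConeAt_inter_nhds (𝕜 := ℝ) hU).symm ▸ hv)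
  rw [h.map_eq] at hFv
  exact tangentConeAt_mono (image_subset_iff.2 fun x hx => hUX hx.symm) hFv

theorem inv_fderiv_apply (h : IsGermEquiv F G X Y x₀ y₀) (hF : HasFDerivAt F F' x₀)
    (hG : HasFDerivAt G G' y₀) (hv : v ∈ tangentConeAt ℝ X x₀) : G' (F' v) = v := by
  have hGF : HasFDerivWithinAt (G ∘ F) (G'.comp F') X x₀ :=
    (HasFDerivAt.comp x₀ (h.map_eq.symm ▸ hG) hF).hasFDerivWithinAt
  have hid : HasFDerivWithinAt (G ∘ F) (.id ℝ E) X x₀ :=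
    (hasFDerivWithinAt_id x₀ X).congr_of_eventuallyEq h.left_inv
      (by rw [Function.comp_apply, h.map_eq, h.inv_eq, id])
  exact hGF.unique_on hid hv

theorem image_tangentConeAt (h : IsGermEquiv F G X Y x₀ y₀) (hF : HasFDerivAt F F' x₀)
    (hG : HasFDerivAt G G' y₀) : F' '' tangentConeAt ℝ X x₀ = tangentConeAt ℝ Y y₀ :=
  Subset.antisymm (h.mapsTo_tangentConeAt hF).image_subset fun w hw =>
    ⟨G' w, h.symm.mapsTo_tangentConeAt hG hw, h.symm.inv_fderiv_apply hG hF hw⟩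

end IsGermEquiv

theorem HasCriticalHessianWithinAt.not_isGermEquiv_levelSet {E : Type*} [NormedAddCommGroup E]
    [NormedSpace ℝ E] [FiniteDimensional ℝ E] (hE : 2 ≤ Module.finrank ℝ E) {φ ψ : E → ℝ}
    {Q : E →L[ℝ] E →L[ℝ] ℝ} {ψ' : E →L[ℝ] ℝ} {x₀ y₀ : E} {F G : E → E}
    (h : HasCriticalHessianWithinAt φ Q univ x₀) (hφ : ∀ᶠ x in 𝓝 x₀, ContinuousAt φ x)
    (hQ : ∀ u v, Q u v = Q v u) (hnd : ∀ u, (∀ v, Q u v = 0) → u = 0)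
    (hψ : ∀ᶠ y in 𝓝 y₀, ContinuousAt ψ y) (hψ' : HasFDerivAt ψ ψ' y₀) (hne : ψ' ≠ 0)
    (hF : DifferentiableAt ℝ F x₀) (hG : DifferentiableAt ℝ G y₀) :
    ¬ IsGermEquiv F G {x | φ x = φ x₀} {y | ψ y = ψ y₀} x₀ y₀ := by
  intro hFG
  have hcone := tangentConeAt_levelSet_eq_ker hψ hψ' hne
  have himage : fderiv ℝ G y₀ '' ψ'.ker = {v | Q v v = 0} := by
    rw [← hcone, hFG.symm.image_tangentConeAt hG.hasFDerivAt hF.hasFDerivAt,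
      h.tangentConeAt_levelSet_eq hφ hQ hnd]
  have hinj : InjOn (fderiv ℝ G y₀) ψ'.ker := by
    rw [← hcone]
    exact LeftInvOn.injOn (f₁' := fderiv ℝ F x₀) fun w hw =>
      hFG.symm.inv_fderiv_apply hG.hasFDerivAt hF.hasFDerivAt hw
  set W := ψ'.ker.map (fderiv ℝ G y₀).toLinearMap with hW
  have hdim : Module.finrank ℝ W + 1 = Module.finrank ℝ E := by
    rw [hW, ← LinearMap.range_domRestrict,
      LinearMap.finrank_range_of_inj (injOn_iff_injective.1 hinj)]
    exact Module.Dual.finrank_ker_add_one_of_ne_zero (f := ψ'.toLinearMap) fun h₀ =>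
      hne (ContinuousLinearMap.coe_injective h₀)
  have hbot : W ≠ ⊥ := fun hbot => by
    rw [hbot, finrank_bot] at hdim
    omega
  exact coe_ne_setOf_apply_self_eq_zero (B := Q.toBilinForm) ⟨hQ⟩ hnd
    (isCoatom_of_finrank_add_one_eq hdim) hbot himage

end GermEquiv

section Charts

variable {E : Type*} [NormedAddCommGroup E] [NormedSpace ℝ E] {H : Type*} [TopologicalSpace H]
  {I : ModelWithCorners ℝ E H} {M : Type*} [TopologicalSpace M] [ChartedSpace H M]
  {f : M → ℝ} {p : M} {y : E}

theorem contDiffWithinAt_comp_extChartAt_symm {n : ℕ∞ω} [IsManifold I n M]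
    (hf : ContMDiff I 𝓘(ℝ, ℝ) n f) (hy : y ∈ (extChartAt I p).target) :
    ContDiffWithinAt ℝ n (f ∘ (extChartAt I p).symm) (range I) y :=
  contMDiffWithinAt_iff_contDiffWithinAt.1 <|
    (hf _).comp_contMDiffWithinAt y (contMDiffWithinAt_extChartAt_symm_range p hy)

theorem extChartAt_target_mem_nhds_of_isInteriorPoint (hp : I.IsInteriorPoint p) :
    (extChartAt I p).target ∈ 𝓝 (extChartAt I p p) := by
  have h := extChartAt_target_mem_nhdsWithin (I := I) p
  rwa [nhdsWithin_eq_nhds.2 (range_mem_nhds_isInteriorPoint hp)] at h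

theorem eventually_continuousAt_comp_extChartAt_symm (hf : Continuous f)
    (hp : I.IsInteriorPoint p) :
    ∀ᶠ y in 𝓝 (extChartAt I p p), ContinuousAt (f ∘ (extChartAt I p).symm) y := by
  filter_upwards [extChartAt_target_mem_nhds_of_isInteriorPoint hp] with y hy
  exact hf.continuousAt.comp (continuousAt_extChartAt_symm'' hy)

theorem chartHessian_const (c : ℝ) (p : M) : chartHessian I (fun _ : M => c) p = 0 := by
  have h : fderivWithin ℝ ((fun _ : M => c) ∘ (extChartAt I p).symm) (range I) = 0 :=
    fderivWithin_const c
  rw [chartHessian, h, fderivWithin_zero, Pi.zero_apply]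

theorem IsMorseFunction.isEmpty_of_const [Nontrivial E] {c : ℝ}
    (hf : IsMorseFunction I fun _ : M => c) : IsEmpty M := by
  obtain ⟨v, hv⟩ := exists_ne (0 : E)
  refine ⟨fun p => hv (hf.nondegenerate p mfderiv_const v fun w => ?_)⟩
  rw [chartHessian_const, zero_apply, zero_apply]

section FirstOrder

variable [IsManifold I 1 M]

theorem fderivWithin_comp_extChartAt_symm
    (hf : MDifferentiableAt I 𝓘(ℝ, ℝ) f ((extChartAt I p).symm y))
    (hy : y ∈ (extChartAt I p).target) :
    fderivWithin ℝ (f ∘ (extChartAt I p).symm) (range I) y =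
      (mfderiv I 𝓘(ℝ, ℝ) f ((extChartAt I p).symm y)).comp
        (mfderivWithin 𝓘(ℝ, E) I (extChartAt I p).symm (range I) y) := by
  rw [← mfderivWithin_eq_fderivWithin]
  exact mfderiv_comp_mfderivWithin y hf (mdifferentiableWithinAt_extChartAt_symm hy)
    (I.uniqueDiffOn _ (extChartAt_target_subset_range p hy)).uniqueMDiffWithinAt

theorem isCriticalPt_extChartAt_symm_iff
    (hf : MDifferentiableAt I 𝓘(ℝ, ℝ) f ((extChartAt I p).symm y))
    (hy : y ∈ (extChartAt I p).target) :
    IsCriticalPt I f ((extChartAt I p).symm y) ↔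
      fderivWithin ℝ (f ∘ (extChartAt I p).symm) (range I) y = 0 := by
  rw [fderivWithin_comp_extChartAt_symm hf hy, IsCriticalPt]
  refine ⟨fun h => by rw [h]; exact ContinuousLinearMap.zero_comp _, fun h => ?_⟩
  obtain ⟨A, hA⟩ := isInvertible_mfderivWithin_extChartAt_symm hy
  rw [← hA] at h
  ext v
  exact (congrArg _ (A.apply_symm_apply v).symm).trans (DFunLike.congr_fun h (A.symm v))

theorem isCriticalPt_iff (hf : MDifferentiableAt I 𝓘(ℝ, ℝ) f p) : IsCriticalPt I f p ↔
    fderivWithin ℝ (f ∘ (extChartAt I p).symm) (range I) (extChartAt I p p) = 0 := by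
  rw [← isCriticalPt_extChartAt_symm_iff (by rwa [extChartAt_to_inv]) (mem_extChartAt_target p),
    extChartAt_to_inv]

theorem tendsto_fderivWithin_comp_extChartAt_symm (hf : ContMDiff I 𝓘(ℝ, ℝ) 1 f) (p : M) :
    Tendsto (fderivWithin ℝ (f ∘ (extChartAt I p).symm) (range I))
      (𝓝[range I] (extChartAt I p p))
      (𝓝 (fderivWithin ℝ (f ∘ (extChartAt I p).symm) (range I) (extChartAt I p p))) :=
  ((contDiffWithinAt_comp_extChartAt_symm hf (mem_extChartAt_target p)).fderivWithin_right
    (m := 0) I.uniqueDiffOn le_rfl (extChartAt_target_subset_range p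
      (mem_extChartAt_target p))).continuousWithinAt

theorem isClosed_setOf_isCriticalPt (hf : ContMDiff I 𝓘(ℝ, ℝ) 1 f) :
    IsClosed {x | IsCriticalPt I f x} := by
  refine isOpen_compl_iff.1 (isOpen_iff_eventually.2 fun p hp => ?_)
  have hmd := hf.mdifferentiable one_ne_zero
  rw [← map_extChartAt_symm_nhdsWithin_range (I := I) p, eventually_map]
  filter_upwards [extChartAt_target_mem_nhdsWithin p,
    (tendsto_fderivWithin_comp_extChartAt_symm hf p).eventually_ne
      (mt (isCriticalPt_iff (hmd p)).2 hp)] with y hy hne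
  exact mt (isCriticalPt_extChartAt_symm_iff (hmd _) hy).1 hne

end FirstOrder

section SecondOrder

variable [IsManifold I 2 M]

theorem hasFDerivWithinAt_chartHessian (hf : ContMDiff I 𝓘(ℝ, ℝ) 2 f) (p : M) :
    HasFDerivWithinAt (fderivWithin ℝ (f ∘ (extChartAt I p).symm) (range I))
      (chartHessian I f p) (range I) (extChartAt I p p) :=
  (((contDiffWithinAt_comp_extChartAt_symm hf (mem_extChartAt_target p)).fderivWithin_right
    (m := 1) I.uniqueDiffOn one_add_one_eq_two.le (extChartAt_target_subset_range p
      (mem_extChartAt_target p))).differentiableWithinAt one_ne_zero).hasFDerivWithinAt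

theorem chartHessian_symm (hf : ContMDiff I 𝓘(ℝ, ℝ) 2 f) (p : M) (u v : E) :
    chartHessian I f p u v = chartHessian I f p v u := by
  have hp := extChartAt_target_subset_range p (mem_extChartAt_target (I := I) p)
  exact (contDiffWithinAt_comp_extChartAt_symm hf
    (mem_extChartAt_target p)).isSymmSndFDerivWithinAt (by simp) I.uniqueDiffOn
      (I.range_subset_closure_interior hp) hp u v

theorem IsCriticalPt.hasCriticalHessianWithinAt (hc : IsCriticalPt I f p)
    (hf : ContMDiff I 𝓘(ℝ, ℝ) 2 f) :
    HasCriticalHessianWithinAt (f ∘ (extChartAt I p).symm) (chartHessian I f p) (range I)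
      (extChartAt I p p) := by
  refine hasCriticalHessianWithinAt_of_hasFDerivWithinAt I.convex_range
    (extChartAt_target_subset_range p (mem_extChartAt_target p)) ?_
    ((isCriticalPt_iff (hf.mdifferentiable two_ne_zero p)).1 hc)
    (hasFDerivWithinAt_chartHessian hf p) (chartHessian_symm hf p)
  filter_upwards [extChartAt_target_mem_nhdsWithin (I := I) p] with y hy
  exact ((contDiffWithinAt_comp_extChartAt_symm hf hy).differentiableWithinAt
    two_ne_zero).hasFDerivWithinAt

theorem IsMorseFunction.eventually_not_isCriticalPt [FiniteDimensional ℝ E]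
    (hf : IsMorseFunction I f) (hc : IsCriticalPt I f p) :
    ∀ᶠ x in 𝓝[≠] p, ¬ IsCriticalPt I f x := by
  have hf₂ : ContMDiff I 𝓘(ℝ, ℝ) 2 f := hf.smooth.of_le ENat.LEInfty.out
  have hker : LinearMap.ker (chartHessian I f p).toLinearMap = ⊥ :=
    LinearMap.ker_eq_bot'.2 fun u hu => hf.nondegenerate p hc u (DFunLike.congr_fun hu)
  obtain ⟨C, -, hC⟩ := (chartHessian I f p).toLinearMap.exists_antilipschitzWith hker
  have hne := (hasFDerivWithinAt_chartHessian hf₂ p).eventually_ne (c := 0) ⟨C, hC⟩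
  rw [eventually_nhdsWithin_iff, ← map_extChartAt_symm_nhdsWithin_range (I := I) p, eventually_map]
  rw [sdiff_eq, nhdsWithin_inter', eventually_inf_principal] at hne
  filter_upwards [hne, extChartAt_target_mem_nhdsWithin p] with y hyne hy hyp
  refine mt (isCriticalPt_extChartAt_symm_iff (hf₂.mdifferentiable two_ne_zero _) hy).1
    (hyne fun h => hyp ?_)
  rw [mem_singleton_iff.1 h, extChartAt_to_inv, mem_singleton_iff]

theorem IsMorseFunction.finite_setOf_isCriticalPt [FiniteDimensional ℝ E] [CompactSpace M]
    (hf : IsMorseFunction I f) : {x | IsCriticalPt I f x}.Finite := by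
  by_contra hinf
  obtain ⟨p, hp⟩ := Set.Infinite.exists_accPt_principal hinf
  have hpc : IsCriticalPt I f p :=
    (isClosed_setOf_isCriticalPt (hf.smooth.of_le ENat.LEInfty.out)).closure_subset
      (mem_closure_iff_clusterPt.2 hp.clusterPt)
  exact accPt_iff_frequently_nhdsNE.1 hp (hf.eventually_not_isCriticalPt hpc)

end SecondOrder

end Charts

section Gradient

theorem exists_pos_forall_le_of_eventually {X : Type*} [TopologicalSpace X] [CompactSpace X]
    {g : X → ℝ} (h : ∀ p, ∃ C > 0, ∀ᶠ x in 𝓝 p, C ≤ g x) : ∃ C > 0, ∀ x, C ≤ g x := by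
  have hC : ∀ᶠ C in 𝓝[>] (0 : ℝ), ∀ x ∈ univ, C ≤ g x := by
    refine isCompact_univ.induction_on (p := fun s => ∀ᶠ C in 𝓝[>] (0 : ℝ), ∀ x ∈ s, C ≤ g x)
      (by simp) (fun s t hst ht => ht.mono fun C hC x hx => hC x (hst hx))
      (fun s t hs ht => ?_) fun p _ => ?_
    · filter_upwards [hs, ht] with C hs ht x hx
      exact hx.elim (hs x) (ht x)
    · obtain ⟨C, hC, hCp⟩ := h p
      refine ⟨_, nhdsWithin_le_nhds hCp, ?_⟩
      filter_upwards [Ioo_mem_nhdsGT hC] with C' hC' x hx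
      exact hC'.2.le.trans hx
  obtain ⟨C, hC, hC₀⟩ := (hC.and self_mem_nhdsWithin).exists
  exact ⟨C, hC₀, fun x => hC x (mem_univ x)⟩

variable {E : Type*} [NormedAddCommGroup E] [NormedSpace ℝ E] [FiniteDimensional ℝ E]
  {H : Type*} [TopologicalSpace H] {I : ModelWithCorners ℝ E H} {M : Type*} [TopologicalSpace M]
  [ChartedSpace H M] [RiemannianBundle (fun x : M => TangentSpace I x)] {f : M → ℝ}

theorem inner_riemannianGradient (f : M → ℝ) (x : M) (v : TangentSpace I x) :
    inner ℝ (riemannianGradient I f x) v = mfderiv I 𝓘(ℝ, ℝ) f x v :=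
  haveI : FiniteDimensional ℝ (TangentSpace I x) := inferInstanceAs (FiniteDimensional ℝ E)
  haveI : CompleteSpace (TangentSpace I x) := FiniteDimensional.complete ℝ (TangentSpace I x)
  InnerProductSpace.toDual_symm_apply

variable [IsManifold I 1 M] [IsContinuousRiemannianBundle E (fun x : M => TangentSpace I x)]

theorem exists_norm_fderivWithin_le_norm_riemannianGradient (hf : MDifferentiable I 𝓘(ℝ, ℝ) f)
    (p : M) : ∃ C > 0, ∀ᶠ y in 𝓝[range I] (extChartAt I p p),
      ‖fderivWithin ℝ (f ∘ (extChartAt I p).symm) (range I) y‖ ≤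
        ‖riemannianGradient I f ((extChartAt I p).symm y)‖ * C := by
  let := fun y : E => normedAddCommGroupTangentSpaceVectorSpace y
  let := fun y : E => normedSpaceTangentSpaceVectorSpace y
  obtain ⟨C, hC, hCp⟩ := eventually_norm_mfderivWithin_symm_extChartAt_lt I p
  refine ⟨C, hC, ?_⟩
  filter_upwards [hCp, extChartAt_target_mem_nhdsWithin p] with y hyC hy
  refine ContinuousLinearMap.opNorm_le_bound _ (mul_nonneg (norm_nonneg _) hC.le) fun v => ?_
  set w := mfderivWithin 𝓘(ℝ, E) I (extChartAt I p).symm (range I) y v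
  calc ‖fderivWithin ℝ (f ∘ (extChartAt I p).symm) (range I) y v‖
      = ‖inner ℝ (riemannianGradient I f ((extChartAt I p).symm y)) w‖ := by
        rw [fderivWithin_comp_extChartAt_symm (hf _) hy, inner_riemannianGradient]
        rfl
    _ ≤ ‖riemannianGradient I f ((extChartAt I p).symm y)‖ * ‖w‖ := norm_inner_le_norm _ _
    _ ≤ ‖riemannianGradient I f ((extChartAt I p).symm y)‖ * (C * ‖v‖) := by
        gcongr
        exact ContinuousLinearMap.le_of_opNorm_le _ hyC.le v
    _ = ‖riemannianGradient I f ((extChartAt I p).symm y)‖ * C * ‖v‖ := (mul_assoc _ _ _).symm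

theorem exists_pos_eventually_le_norm_riemannianGradient (hf : ContMDiff I 𝓘(ℝ, ℝ) 1 f) {p : M}
    (hp : ¬ IsCriticalPt I f p) : ∃ C > 0, ∀ᶠ x in 𝓝 p, C ≤ ‖riemannianGradient I f x‖ := by
  have hmd := hf.mdifferentiable one_ne_zero
  have hpos := norm_pos_iff.2 (mt (isCriticalPt_iff (hmd p)).2 hp)
  obtain ⟨C, hC, hCp⟩ := exists_norm_fderivWithin_le_norm_riemannianGradient hmd p
  refine ⟨_, div_pos (half_pos hpos) hC, ?_⟩
  rw [← map_extChartAt_symm_nhdsWithin_range (I := I) p, eventually_map]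
  filter_upwards [hCp, (tendsto_fderivWithin_comp_extChartAt_symm hf p).norm.eventually_const_lt
    (half_lt_self hpos)] with y hy hy'
  exact (div_le_iff₀ hC).2 (hy'.le.trans hy)

theorem exists_pos_forall_le_norm_riemannianGradient [CompactSpace M]
    (hf : ContMDiff I 𝓘(ℝ, ℝ) 1 f) (hc : ∀ x, ¬ IsCriticalPt I f x) :
    ∃ C > 0, ∀ x, C ≤ ‖riemannianGradient I f x‖ :=
  exists_pos_forall_le_of_eventually fun p =>
    exists_pos_eventually_le_norm_riemannianGradient hf (hc p)

end Gradient

section Diffeomorphic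

theorem IsGermEquiv.of_equiv {α β : Type*} [TopologicalSpace α] [TopologicalSpace β] {X : Set α}
    {Y : Set β} (e : X ≃ Y) (x : X) {F : α → β} {G : β → α} (hF : ContinuousAt F x)
    (hG : ContinuousAt G (e x)) (hFe : ∀ᶠ x' in 𝓝 (x : α), ∀ h : x' ∈ X, F x' = e ⟨x', h⟩)
    (hGe : ∀ᶠ y in 𝓝 (e x : β), ∀ h : y ∈ Y, G y = e.symm ⟨y, h⟩) :
    IsGermEquiv F G X Y x (e x) := by
  have hx : F x = e x := hFe.self_of_nhds x.2
  have hy : G (e x) = x := by rw [hGe.self_of_nhds (e x).2, Subtype.coe_eta, e.symm_apply_apply]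
  have hFX : Tendsto F (𝓝[X] x) (𝓝[Y] e x) := tendsto_nhdsWithin_iff.2
    ⟨hx ▸ hF.continuousWithinAt, eventually_nhdsWithin_iff.2 <| hFe.mono fun x' h hx' => by
      rw [h hx']
      exact (e ⟨x', hx'⟩).2⟩
  have hGY : Tendsto G (𝓝[Y] e x) (𝓝[X] x) := tendsto_nhdsWithin_iff.2
    ⟨by simpa only [hy] using hG.continuousWithinAt.tendsto, eventually_nhdsWithin_iff.2 <|
      hGe.mono fun y h hy' => by
        rw [h hy']
        exact (e.symm ⟨y, hy'⟩).2⟩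
  refine ⟨hx, hy, hFX, hGY, ?_, ?_⟩
  · filter_upwards [self_mem_nhdsWithin, nhdsWithin_le_nhds hFe,
      hFX.eventually (nhdsWithin_le_nhds hGe)] with x' hx' hFx' hGx'
    rw [hFx' hx'] at hGx' ⊢
    rw [hGx' (e ⟨x', hx'⟩).2, Subtype.coe_eta, e.symm_apply_apply]
  · filter_upwards [self_mem_nhdsWithin, nhdsWithin_le_nhds hGe,
      hGY.eventually (nhdsWithin_le_nhds hFe)] with y hy' hGy hFy
    rw [hGy hy'] at hFy ⊢
    rw [hFy (e.symm ⟨y, hy'⟩).2, Subtype.coe_eta, e.apply_symm_apply]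

variable {E : Type*} [NormedAddCommGroup E] [NormedSpace ℝ E] {H : Type*} [TopologicalSpace H]
  {I : ModelWithCorners ℝ E H} {M : Type*} [TopologicalSpace M] [ChartedSpace H M]

theorem SmoothOnSubset.exists_contMDiffAt {E' : Type*} [NormedAddCommGroup E'] [NormedSpace ℝ E']
    {H' : Type*} [TopologicalSpace H'] {J : ModelWithCorners ℝ E' H'} {N : Type*}
    [TopologicalSpace N] [ChartedSpace H' N] {X : Set M} {g : X → N}
    (hg : SmoothOnSubset I J X g) (x : X) : ∃ F : M → N, ContMDiffAt I J ∞ F x ∧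
      ∀ᶠ y in 𝓝 (x : M), ∀ hy : y ∈ X, F y = g ⟨y, hy⟩ := by
  obtain ⟨U, hU, hxU, F, hF, hFg⟩ := hg x
  exact ⟨F, hF.contMDiffAt (hU.mem_nhds hxU),
    (hU.eventually_mem hxU).mono fun y hyU hy => hFg ⟨y, hy⟩ hyU⟩

theorem DiffeomorphicSubsets.exists_isGermEquiv {X Y : Set M} (h : DiffeomorphicSubsets I X Y)
    {x : M} (hx : x ∈ X) : ∃ y ∈ Y, ∃ F G : M → M,
      ContMDiffAt I I ∞ F x ∧ ContMDiffAt I I ∞ G y ∧ IsGermEquiv F G X Y x y := by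
  obtain ⟨e, he, he'⟩ := h
  obtain ⟨F, hF, hFe⟩ := he.exists_contMDiffAt ⟨x, hx⟩
  obtain ⟨G, hG, hGe⟩ := he'.exists_contMDiffAt (e ⟨x, hx⟩)
  exact ⟨e ⟨x, hx⟩, (e ⟨x, hx⟩).2, F, G, hF, hG,
    .of_equiv e ⟨x, hx⟩ hF.continuousAt hG.continuousAt hFe hGe⟩

theorem isGermEquiv_extChartAt {p : M} (hp : I.IsInteriorPoint p) (X : Set M) :
    IsGermEquiv (extChartAt I p) (extChartAt I p).symm X ((extChartAt I p).symm ⁻¹' X) p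
      (extChartAt I p p) where
  map_eq := rfl
  inv_eq := extChartAt_to_inv p
  tendsto := by
    refine tendsto_nhdsWithin_iff.2 ⟨(continuousAt_extChartAt p).continuousWithinAt, ?_⟩
    filter_upwards [self_mem_nhdsWithin, nhdsWithin_le_nhds (extChartAt_source_mem_nhds (I := I) p)]
      with x hx hxs
    rwa [mem_preimage, (extChartAt I p).left_inv hxs]
  tendsto_inv := tendsto_nhdsWithin_iff.2
    ⟨by simpa only [extChartAt_to_inv] using
      (continuousAt_extChartAt_symm (I := I) p).continuousWithinAt.tendsto, self_mem_nhdsWithin⟩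
  left_inv := by
    filter_upwards [nhdsWithin_le_nhds (extChartAt_source_mem_nhds (I := I) p)] with x hx
    exact (extChartAt I p).left_inv hx
  right_inv := by
    filter_upwards [nhdsWithin_le_nhds (extChartAt_target_mem_nhds_of_isInteriorPoint hp)] with y hy
    exact (extChartAt I p).right_inv hy

variable [FiniteDimensional ℝ E] [IsManifold I 2 M] {f : M → ℝ} {p q : M}

theorem IsMorseFunction.not_isGermEquiv_fiber (hf : IsMorseFunction I f)
    (hE : 2 ≤ Module.finrank ℝ E) (hp : I.IsInteriorPoint p) (hq : I.IsInteriorPoint q)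
    (hcp : IsCriticalPt I f p) (hcq : ¬ IsCriticalPt I f q) {F G : M → M}
    (hF : MDifferentiableAt I I F p) (hG : MDifferentiableAt I I G q) :
    ¬ IsGermEquiv F G (f ⁻¹' {f p}) (f ⁻¹' {f q}) p q := by
  intro hFG
  have hf₂ : ContMDiff I 𝓘(ℝ, ℝ) 2 f := hf.smooth.of_le ENat.LEInfty.out
  have : IsManifold I 1 M := .of_le one_le_two
  obtain rfl := hFG.map_eq
  have hcont := fun r hr => eventually_continuousAt_comp_extChartAt_symm (I := I) (p := r)
    hf₂.continuous hr
  have hrange := range_mem_nhds_isInteriorPoint hp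
  have hrange' := range_mem_nhds_isInteriorPoint hq
  have hψ := ((contDiffWithinAt_comp_extChartAt_symm hf₂
    (mem_extChartAt_target (F p))).differentiableWithinAt two_ne_zero).hasFDerivWithinAt
  have hG' := hG.differentiableWithinAt_writtenInExtChartAt.differentiableAt hrange'
  rw [writtenInExtChartAt, hFG.inv_eq] at hG'
  refine ((hcp.hasCriticalHessianWithinAt hf₂).univ_of_mem_nhds hrange).not_isGermEquiv_levelSet
    hE (hcont p hp) (chartHessian_symm hf₂ p) (hf.nondegenerate p hcp) (hcont _ hq)
    (hψ.hasFDerivAt hrange') (mt (isCriticalPt_iff (hf₂.mdifferentiable two_ne_zero _)).2 hcq)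
    (hF.differentiableWithinAt_writtenInExtChartAt.differentiableAt hrange) hG' ?_
  simp only [Function.comp_apply, extChartAt_to_inv]
  exact ((isGermEquiv_extChartAt hp _).symm.trans hFG).trans (isGermEquiv_extChartAt hq _)

theorem IsMorseFunction.not_isCriticalPt_of_diffeomorphicSubsets (hf : IsMorseFunction I f)
    (hE : 2 ≤ Module.finrank ℝ E) {d : ℝ} (hd : ∀ q, f q = d → I.IsInteriorPoint q)
    (hreg : ∀ q, f q = d → ¬ IsCriticalPt I f q) (hp : I.IsInteriorPoint p)
    (h : DiffeomorphicSubsets I (f ⁻¹' {f p}) (f ⁻¹' {d})) : ¬ IsCriticalPt I f p := by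
  intro hcp
  obtain ⟨q, rfl, F, G, hF, hG, hFG⟩ := h.exists_isGermEquiv (x := p) rfl
  exact hf.not_isGermEquiv_fiber hE hp (hd q rfl) hcp (hreg q rfl)
    (hF.mdifferentiableAt (by simp)) (hG.mdifferentiableAt (by simp)) hFG

end Diffeomorphic

section Boundary

theorem eventually_eq_of_mapsTo_finite {X Y : Type*} [TopologicalSpace X] [TopologicalSpace Y]
    [T1Space Y] {g : X → Y} {s : Set X} {t : Set Y} {x₀ : X} (ht : t.Finite) (hg : MapsTo g s t)
    (hc : ContinuousAt g x₀) : ∀ᶠ x in 𝓝[s] x₀, g x = g x₀ := by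
  have hmem : (t \ {g x₀})ᶜ ∈ 𝓝 (g x₀) := ht.sdiff.isClosed.isOpen_compl.mem_nhds (by simp)
  filter_upwards [self_mem_nhdsWithin, nhdsWithin_le_nhds (hc hmem)] with x hxs hx
  by_contra hne
  exact hx ⟨hg hxs, hne⟩

variable {n : ℕ} [NeZero n]

theorem eventually_add_smul_mem_range_modelWithCornersEuclideanHalfSpace
    {x v : EuclideanSpace ℝ (Fin n)} (hx : x 0 = 0) (hv : 0 ≤ v 0) :
    ∀ᶠ t : ℝ in 𝓝[>] 0, x + t • v ∈ range (𝓡∂ n) := by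
  filter_upwards [self_mem_nhdsWithin] with t (ht : 0 < t)
  rw [range_modelWithCornersEuclideanHalfSpace, mem_ofPred_eq, PiLp.add_apply, PiLp.smul_apply, hx,
    zero_add]
  exact mul_nonneg ht.le hv

variable {M : Type*} [TopologicalSpace M] [ChartedSpace (EuclideanHalfSpace n) M] {f : M → ℝ}
  {p : M}

theorem extChartAt_apply_zero_of_mem_boundary (hp : p ∈ (𝓡∂ n).boundary M) :
    extChartAt (𝓡∂ n) p p 0 = 0 := by
  have h : extChartAt (𝓡∂ n) p p ∈ frontier (range (𝓡∂ n)) := hp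
  rw [frontier_range_modelWithCornersEuclideanHalfSpace] at h
  exact h.symm

theorem extChartAt_symm_mem_boundary [IsManifold (𝓡∂ n) 1 M] {y : EuclideanSpace ℝ (Fin n)}
    (hy : y ∈ (extChartAt (𝓡∂ n) p).target) (hy₀ : y 0 = 0) :
    (extChartAt (𝓡∂ n) p).symm y ∈ (𝓡∂ n).boundary M := by
  refine (ModelWithCorners.isBoundaryPoint_iff_not_isInteriorPoint _).2 fun hint => ?_
  have hmem := interior_mono (extChartAt_target_subset_range p) <|
    (ModelWithCorners.isInteriorPoint_iff_of_mem_atlas one_ne_zero (chart_mem_atlas _ p)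
      (by simpa only [extChartAt_source] using (extChartAt (𝓡∂ n) p).map_target hy)).1 hint
  rw [interior_range_modelWithCornersEuclideanHalfSpace, mem_ofPred_eq, ← extChartAt,
    (extChartAt (𝓡∂ n) p).right_inv hy] at hmem
  exact hmem.ne' hy₀

variable [IsManifold (𝓡∂ n) 2 M]

namespace IsCriticalPt

theorem chartHessian_apply_self_eq_zero (hc : IsCriticalPt (𝓡∂ n) f p)
    (hf : ContMDiff (𝓡∂ n) 𝓘(ℝ, ℝ) 2 f) (hp : p ∈ (𝓡∂ n).boundary M)
    (hconst : ∀ᶠ x in 𝓝[(𝓡∂ n).boundary M] p, f x = f p) {v : EuclideanSpace ℝ (Fin n)}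
    (hv : v 0 = 0) : chartHessian (𝓡∂ n) f p v v = 0 := by
  have : IsManifold (𝓡∂ n) 1 M := .of_le one_le_two
  have hp₀ := extChartAt_apply_zero_of_mem_boundary hp
  have hrange := eventually_add_smul_mem_range_modelWithCornersEuclideanHalfSpace hp₀ hv.ge
  have htend := tendsto_add_smul_nhdsGT (extChartAt (𝓡∂ n) p p) v
  have hsymm := (continuousAt_extChartAt_symm (I := 𝓡∂ n) p).tendsto.comp htend
  rw [extChartAt_to_inv] at hsymm
  refine (hc.hasCriticalHessianWithinAt hf).apply_self_eq_zero_of_mem_tangentConeAt <|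
    mem_tangentConeAt_of_add_smul_mem (tendsto_id'.2 (nhdsGT_le_nhdsNE 0)) ?_
  filter_upwards [hrange, (tendsto_nhdsWithin_iff.2 ⟨htend, hrange⟩).eventually
    (extChartAt_target_mem_nhdsWithin (I := 𝓡∂ n) p),
    hsymm.eventually (eventually_nhdsWithin_iff.1 hconst)] with t htr ht htc
  refine ⟨htr, (htc (extChartAt_symm_mem_boundary ht ?_)).trans (congrArg f ?_)⟩
  · rw [PiLp.add_apply, PiLp.smul_apply, hp₀, hv, smul_zero, zero_add]
  · exact (extChartAt_to_inv p).symm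

end IsCriticalPt

theorem IsMorseFunction.exists_chartHessian_apply_self_eq (hf : IsMorseFunction (𝓡∂ n) f)
    (hn : 2 ≤ n) (hp : p ∈ (𝓡∂ n).boundary M) (hc : IsCriticalPt (𝓡∂ n) f p)
    (hconst : ∀ᶠ x in 𝓝[(𝓡∂ n).boundary M] p, f x = f p) (r : ℝ) :
    ∃ v : EuclideanSpace ℝ (Fin n), 0 ≤ v 0 ∧ chartHessian (𝓡∂ n) f p v v = r := by
  have hf₂ : ContMDiff (𝓡∂ n) 𝓘(ℝ, ℝ) 2 f := hf.smooth.of_le ENat.LEInfty.out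
  let proj : EuclideanSpace ℝ (Fin n) →ₗ[ℝ] ℝ := (EuclideanSpace.proj (0 : Fin n)).toLinearMap
  let e : Fin n → EuclideanSpace ℝ (Fin n) := fun i => EuclideanSpace.single i 1
  have hproj : proj (e 0) = 1 := by simp [proj, e]
  have hproj₁ : proj (e ⟨1, hn⟩) = 0 := by simp [proj, e, Fin.ext_iff]
  have hbot : LinearMap.ker proj ≠ ⊥ := (Submodule.ne_bot_iff _).2 ⟨e ⟨1, hn⟩, hproj₁, by simp [e]⟩
  have hsurj : Function.Surjective proj := fun c =>
    ⟨c • e 0, by rw [map_smul, hproj, smul_eq_mul, mul_one]⟩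
  obtain ⟨w, hw, hwr⟩ := exists_mem_apply_add_self_eq (B := (chartHessian (𝓡∂ n) f p).toBilinForm)
    ⟨chartHessian_symm hf₂ p⟩ (hf.nondegenerate p hc) (LinearMap.isCoatom_ker_of_surjective hsurj)
    hbot (fun w hw => hc.chartHessian_apply_self_eq_zero hf₂ hp hconst hw)
    (fun h => one_ne_zero (hproj.symm.trans h)) r
  have hv : proj (e 0 + w) = 1 := by rw [map_add, hproj, hw, add_zero]
  exact ⟨e 0 + w, zero_le_one.trans_eq hv.symm, hwr⟩

theorem IsMorseFunction.not_isLocalExtr_of_mem_boundary (hf : IsMorseFunction (𝓡∂ n) f)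
    (hn : 2 ≤ n) (hp : p ∈ (𝓡∂ n).boundary M) (hc : IsCriticalPt (𝓡∂ n) f p)
    (hconst : ∀ᶠ x in 𝓝[(𝓡∂ n).boundary M] p, f x = f p) : ¬ IsLocalExtr f p := by
  have hess := hc.hasCriticalHessianWithinAt (hf.smooth.of_le ENat.LEInfty.out)
  have hray := fun {v} => eventually_add_smul_mem_range_modelWithCornersEuclideanHalfSpace (v := v)
    (extChartAt_apply_zero_of_mem_boundary hp)
  have hsymm := (continuousAt_extChartAt_symm (I := 𝓡∂ n) p).continuousWithinAt (s := range (𝓡∂ n))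
  have hpp := extChartAt_to_inv (I := 𝓡∂ n) p
  rintro (hmin | hmax)
  · obtain ⟨v, hv₀, hv⟩ := hf.exists_chartHessian_apply_self_eq hn hp hc hconst (-1)
    have hmin' := IsMinFilter.comp_tendsto (b := extChartAt (𝓡∂ n) p p) (hpp.symm ▸ hmin) hsymm
    linarith [hess.apply_self_nonneg_of_isLocalMinOn hmin' (hray hv₀)]
  · obtain ⟨v, hv₀, hv⟩ := hf.exists_chartHessian_apply_self_eq hn hp hc hconst 1
    have hmax' := IsMaxFilter.comp_tendsto (b := extChartAt (𝓡∂ n) p p) (hpp.symm ▸ hmax) hsymm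
    linarith [hess.apply_self_nonpos_of_isLocalMaxOn hmax' (hray hv₀)]

end Boundary

section Main

variable {n : ℕ} [NeZero n] {M : Type*} [TopologicalSpace M]
  [ChartedSpace (EuclideanHalfSpace n) M] [IsManifold (𝓡∂ n) 2 M] {a b : ℝ} {f : M → ℝ}

theorem IsMorseFunction.isInteriorPoint_of_isCriticalPt (hf : IsMorseFunction (𝓡∂ n) f)
    (hn : 2 ≤ n) (hfab : ∀ x, f x ∈ Icc a b) (hbdry : MapsTo f ((𝓡∂ n).boundary M) {a, b}) {p : M}
    (hc : IsCriticalPt (𝓡∂ n) f p) : (𝓡∂ n).IsInteriorPoint p := by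
  refine (ModelWithCorners.isInteriorPoint_iff_not_isBoundaryPoint p).2 fun hp => ?_
  refine hf.not_isLocalExtr_of_mem_boundary hn hp hc (eventually_eq_of_mapsTo_finite
    (toFinite _) hbdry hf.smooth.continuous.continuousAt) ?_
  exact (hbdry hp).imp (fun h => .of_forall fun x => h.trans_le (hfab x).1)
    (fun h => .of_forall fun x => (hfab x).2.trans_eq (Eq.symm h))

theorem IsMorseFunction.not_isCriticalPt [CompactSpace M] (hf : IsMorseFunction (𝓡∂ n) f)
    (hn : 2 ≤ n) (hfab : ∀ x, f x ∈ Icc a b) (hbdry : MapsTo f ((𝓡∂ n).boundary M) {a, b})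
    (hlevel : ∀ c ∈ Icc a b, ∀ d ∈ Icc a b,
      DiffeomorphicSubsets (𝓡∂ n) (f ⁻¹' {c}) (f ⁻¹' {d})) (p : M) :
    ¬ IsCriticalPt (𝓡∂ n) f p := by
  intro hc
  have hab : a < b := (hfab p).1.trans (hfab p).2 |>.lt_of_ne fun h => by
    obtain rfl : f = fun _ => b := funext fun x => (Icc_self b).subset (h ▸ hfab x)
    exact hf.isEmpty_of_const.false p
  obtain ⟨d, hd, hdreg⟩ :=
    ((Ioo_infinite hab).sdiff (hf.finite_setOf_isCriticalPt.image f)).nonempty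
  refine hf.not_isCriticalPt_of_diffeomorphicSubsets (by simpa using hn) (fun q hq => ?_)
    (fun q hq hcq => hdreg ⟨q, hcq, hq⟩) (hf.isInteriorPoint_of_isCriticalPt hn hfab hbdry hc)
    (hlevel (f p) (hfab p) d (Ioo_subset_Icc_self hd)) hc
  refine (ModelWithCorners.isInteriorPoint_iff_not_isBoundaryPoint q).2 fun hqb => ?_
  exact (hbdry hqb).elim (fun h => hd.1.ne' (hq.symm.trans h)) fun h => hd.2.ne (hq.symm.trans h)

end Main

theorem isContinuousRiemannianBundle_of_isContMDiffRiemannianBundle {E : Type*}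
    [NormedAddCommGroup E] [NormedSpace ℝ E] {H : Type*} [TopologicalSpace H]
    (I : ModelWithCorners ℝ E H) (M : Type*) [TopologicalSpace M] [ChartedSpace H M]
    [IsManifold I 1 M] [RiemannianBundle (fun x : M => TangentSpace I x)] (n : ℕ∞ω)
    [h : IsContMDiffRiemannianBundle I n E (fun x : M => TangentSpace I x)] :
    IsContinuousRiemannianBundle E (fun x : M => TangentSpace I x) :=
  let ⟨g, hg, h⟩ := h.exists_contMDiff
  ⟨g, hg.continuous, h⟩

theorem lemma1_general {n : ℕ} [NeZero n] (hn : 2 ≤ n)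
    {M : Type*} [TopologicalSpace M] [CompactSpace M]
    [ChartedSpace (EuclideanHalfSpace n) M] [IsManifold (𝓡∂ n) 2 M]
    [RiemannianBundle (fun x : M => TangentSpace (𝓡∂ n) x)]
    [IsContinuousRiemannianBundle (EuclideanSpace ℝ (Fin n))
      (fun x : M => TangentSpace (𝓡∂ n) x)]
    (a b : ℝ) (f : M → ℝ)
    (hfab : ∀ x, f x ∈ Icc a b)
    (hf : IsMorseFunction (𝓡∂ n) f)
    (hbdry : MapsTo f ((𝓡∂ n).boundary M) {a, b})
    (hlevel : ∀ c ∈ Icc a b, ∀ d ∈ Icc a b,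
      DiffeomorphicSubsets (𝓡∂ n) (f ⁻¹' {c}) (f ⁻¹' {d})) :
    (∀ x, ¬ IsCriticalPt (𝓡∂ n) f x) ∧
      ∃ C : ℝ, 0 < C ∧ ∀ x, C ≤ ‖riemannianGradient (𝓡∂ n) f x‖ := by
  have : IsManifold (𝓡∂ n) 1 M := .of_le one_le_two
  have hcrit := hf.not_isCriticalPt hn hfab hbdry hlevel
  exact ⟨hcrit, exists_pos_forall_le_norm_riemannianGradient
    (hf.smooth.of_le ENat.LEInfty.out) hcrit⟩

theorem lemma1 {n : ℕ} [NeZero n] (hn : 2 ≤ n)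
    {M : Type*} [TopologicalSpace M] [T2Space M] [CompactSpace M]
    [ChartedSpace (EuclideanHalfSpace n) M] [IsManifold (𝓡∂ n) ∞ M]
    [RiemannianBundle (fun x : M => TangentSpace (𝓡∂ n) x)]
    [IsContMDiffRiemannianBundle (𝓡∂ n) ∞ (EuclideanSpace ℝ (Fin n))
      (fun x : M => TangentSpace (𝓡∂ n) x)]
    (a b : ℝ) (f : M → ℝ)
    (hfab : ∀ x, f x ∈ Icc a b)
    (hf : IsMorseFunction (𝓡∂ n) f)
    (hbdry : f '' (𝓡∂ n).boundary M = {a, b})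
    (hlevel : ∀ c ∈ Icc a b, ∀ d ∈ Icc a b,
      DiffeomorphicSubsets (𝓡∂ n) (f ⁻¹' {c}) (f ⁻¹' {d})) :
    (∀ x, ¬ IsCriticalPt (𝓡∂ n) f x) ∧
      ∃ C : ℝ, 0 < C ∧ ∀ x, C ≤ ‖riemannianGradient (𝓡∂ n) f x‖ := by
  have := isContinuousRiemannianBundle_of_isContMDiffRiemannianBundle (𝓡∂ n) M ∞
  exact lemma1_general hn a b f hfab hf (mapsTo_iff_image_subset.2 hbdry.subset) hlevel
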